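/- Let $G$ be a finite group and let $X$ be a finite-dimensional complex representation of $G$ defined over $\mathbb{R}$, i.e. $X$ carries a conjugate-linear involution $x\mapsto\overline{x}$ commuting with $G$; put $X(\mathbb{R})=\{x\in X:\overline{x}=x\}$. Let $h$ be a $G$-invariant Hermitian inner product on $X$. Let $H\subseteq G$ be a subgroup, $X^H=\{x\in X: gx=x\ \forall g\in H\}$, $X(\mathbb{R})^H=X^H\cap X(\mathbb{R})$, and let the effective group $\overline{G}:=N_G(H)/H$ act on $X^H$; assume that this action is faithful (this holds, for instance, whenever $H$ is the stabilizer of a point of $X$). Let $Y^{(H)}=X^H/\!/\overline{G}=\operatorname{Spec}\big(\mathbb{R}[X^H]^{\overline{G}}\big)$, with quotient map $\pi:X^H\to Y^{(H)}(\mathbb{C})$ and real points $Y^{(H)}(\mathbb{R})\subseteq Y^{(H)}(\mathbb{C})$, and let $L_H=\pi\big(X(\mathbb{R})^H\big)\subseteq Y^{(H)}(\mathbb{R})$. With $n=\dim_{\mathbb{C}}X^H$ and $\mathcal{H}^n$ the $n$-dimensional Hausdorff measure on $X^H$ for the distance $\|x-x'\|_h$, define $$\operatorname{vol}(U)=\frac{1}{|\overline{G}|}\,\mathcal{H}^n\big(\pi^{-1}(U)\big)\qquad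 (U\subseteq Y^{(H)}(\mathbb{R})).$$ For $r>0$ let $B(r)\subset Y^{(H)}(\mathbb{R})$ be the ball of radius $r$ centred at the origin $\pi(0)$ for the quotient distance $d(y,y')=\inf\{\|x-x'\|_h:\pi(x)=y,\ \pi(x')=y'\}$. Then $0<\operatorname{vol}(B(r))<\infty$ and $$\frac{\operatorname{vol}\big(L_H\cap B(r)\big)}{\operatorname{vol}\big(B(r)\big)}=\frac{1}{\#\mathrm{Inv}(\overline{G})},\qquad \mathrm{Inv}(\overline{G})=\{\sigma\in\overline{G}:\sigma^2=1\}.$$ -/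

import Mathlib

open MeasureTheory
open scoped ENNReal

/-- A real structure on a complex vector space: a conjugate-linear involution.
Its fixed points are the real points. -/
structure RealStructure (W : Type*) [AddCommGroup W] [Module ℂ W] where
  conj : W →ₗ⋆[ℂ] W
  conj_conj : ∀ x, conj (conj x) = x

/-- The set of real points `W(ℝ)`. -/
def RealStructure.realPoints {W : Type*} [AddCommGroup W] [Module ℂ W]
    (c : RealStructure W) : Set W :=
  {x | c.conj x = x}

section Quotient

variable {W : Type*} [AddCommGroup W] [Module ℂ W] {Γ : Type*} [Group Γ]

/-- The coordinate ring `ℝ[W]`: regular (polynomial) functions `W → ℂ` defined over `ℝ`, i.e. the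
real algebra generated by the complex linear forms that are compatible with conjugation. -/
noncomputable def coordRing (c : RealStructure W) : Subalgebra ℝ (W → ℂ) :=
  Algebra.adjoin ℝ {f | ∃ l : W →ₗ[ℂ] ℂ, (∀ x, l (c.conj x) = star (l x)) ∧ ⇑l = f}

/-- The ring of invariants `ℝ[W]^Γ`. -/
noncomputable def invariantRing (c : RealStructure W) (ρ : Representation ℂ Γ W) : Subalgebra ℝ (W → ℂ) where
  carrier := {f | f ∈ coordRing c ∧ ∀ g x, f (ρ g x) = f x}
  mul_mem' := fun ⟨ha, ha'⟩ ⟨hb, hb'⟩ =>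
    ⟨mul_mem ha hb, fun g x => by simp [ha' g x, hb' g x]⟩
  add_mem' := fun ⟨ha, ha'⟩ ⟨hb, hb'⟩ =>
    ⟨add_mem ha hb, fun g x => by simp [ha' g x, hb' g x]⟩
  algebraMap_mem' := fun t => ⟨Subalgebra.algebraMap_mem _ t, fun _ _ => rfl⟩

/-- The `K`-points `Y(K)` of the categorical quotient `Y = W // Γ = Spec ℝ[W]^Γ`. -/
abbrev QuotPoints (c : RealStructure W) (ρ : Representation ℂ Γ W)
    (K : Type*) [CommRing K] [Algebra ℝ K] : Type _ :=
  invariantRing c ρ →ₐ[ℝ] K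

/-- The quotient map `π : W → Y(ℂ)`, dual to the inclusion `ℝ[W]^Γ ⊆ ℝ[W]`. -/
noncomputable def quotMap (c : RealStructure W) (ρ : Representation ℂ Γ W) (x : W) : QuotPoints c ρ ℂ :=
  (Pi.evalAlgHom ℝ (fun _ : W => ℂ) x).comp (invariantRing c ρ).val

/-- The inclusion `Y(ℝ) ⊆ Y(ℂ)`. -/
noncomputable def realToComplexPoint (c : RealStructure W) (ρ : Representation ℂ Γ W)
    (y : QuotPoints c ρ ℝ) : QuotPoints c ρ ℂ :=
  (Algebra.ofId ℝ ℂ).comp y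

/-- The real image `L = π(W(ℝ))`, as a subset of `Y(ℝ)`. -/
def realImage (c : RealStructure W) (ρ : Representation ℂ Γ W) : Set (QuotPoints c ρ ℝ) :=
  realToComplexPoint c ρ ⁻¹' (quotMap c ρ '' c.realPoints)

end Quotient

section Metric

variable {W : Type*} [NormedAddCommGroup W] [InnerProductSpace ℂ W] {Γ : Type*} [Group Γ]

/-- The quotient distance on `Y(ℂ)`: the distance between the fibres of `π`. -/
noncomputable def quotDist (c : RealStructure W) (ρ : Representation ℂ Γ W)
    (y y' : QuotPoints c ρ ℂ) : ℝ :=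
  sInf {d | ∃ x x' : W, quotMap c ρ x = y ∧ quotMap c ρ x' = y' ∧ d = dist x x'}

/-- The metric ball of radius `r` in `Y(ℝ)` centred at the origin `π(0)`. -/
def quotBall (c : RealStructure W) (ρ : Representation ℂ Γ W) (r : ℝ) :
    Set (QuotPoints c ρ ℝ) :=
  {y | quotDist c ρ (realToComplexPoint c ρ y) (quotMap c ρ 0) < r}

/-- The induced volume on `Y(ℝ)`: `vol(U) = ℋⁿ(π⁻¹(U)) / |Γ|` with `n = dim_ℂ W`, where the
Hausdorff measure is that of the real metric underlying the Hermitian inner product of `W`. -/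
noncomputable def quotVol (c : RealStructure W) (ρ : Representation ℂ Γ W)
    (U : Set (QuotPoints c ρ ℝ)) : ℝ≥0∞ :=
  letI : MeasurableSpace W := borel W
  haveI : BorelSpace W := ⟨rfl⟩
  (Nat.card Γ : ℝ≥0∞)⁻¹ * Measure.hausdorffMeasure (Module.finrank ℂ W : ℝ)
    (quotMap c ρ ⁻¹' (realToComplexPoint c ρ '' U))

end Metric

section Stratum

variable {X : Type*} [AddCommGroup X] [Module ℂ X] {G : Type*} [Group G]

/-- The fixed-point subspace `X^H`. -/
def fixedSpace (ρ : Representation ℂ G X) (H : Subgroup G) : Submodule ℂ X where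
  carrier := {x | ∀ h ∈ H, ρ h x = x}
  add_mem' := fun ha hb h hh => by rw [map_add, ha h hh, hb h hh]
  zero_mem' := fun h _ => map_zero _
  smul_mem' := fun t x hx h hh => by rw [map_smul, hx h hh]

/-- The real structure on `X^H` obtained by restriction. -/
def stratumReal (c : RealStructure X) (ρ : Representation ℂ G X)
    (hc : ∀ g x, ρ g (c.conj x) = c.conj (ρ g x)) (H : Subgroup G) :
    RealStructure (fixedSpace ρ H) where
  conj :=
    { toFun := fun x => ⟨c.conj x, fun h hh => by rw [hc, x.2 h hh]⟩
      map_add' := fun x y => Subtype.ext (map_add c.conj (x : X) (y : X))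
      map_smul' := fun t x => Subtype.ext (map_smulₛₗ c.conj t (x : X)) }
  conj_conj := fun x => Subtype.ext (c.conj_conj x)

theorem normalizer_maps_fixedSpace (ρ : Representation ℂ G X) (H : Subgroup G)
    (n : Subgroup.normalizer (H : Set G)) :
    ∀ x ∈ fixedSpace ρ H, ρ (n : G) x ∈ fixedSpace ρ H := by
  intro x hx h hh
  have h1 : (n : G)⁻¹ * h * n ∈ H := (Subgroup.mem_normalizer_iff''.1 n.2 h).1 hh
  have h2 : ρ h (ρ (n : G) x) = ρ (n : G) (ρ ((n : G)⁻¹ * h * n) x) := by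
    simp only [← Module.End.mul_apply, ← map_mul]
    congr 2
    group
  rw [h2, hx _ h1]

/-- The action of the normalizer `N_G(H)` on `X^H`. -/
def normalizerRep (ρ : Representation ℂ G X) (H : Subgroup G) :
    Representation ℂ (Subgroup.normalizer (H : Set G)) (fixedSpace ρ H) where
  toFun n := (ρ (n : G)).restrict (normalizer_maps_fixedSpace ρ H n)
  map_one' := by ext x; simp
  map_mul' a b := by ext x; simp

/-- The effective group `N_G(H)/H`. -/
abbrev EffectiveGroup (H : Subgroup G) : Type _ :=
  Subgroup.normalizer (H : Set G) ⧸ H.subgroupOf (Subgroup.normalizer (H : Set G))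

/-- The action of the effective group `N_G(H)/H` on `X^H`. -/
def stratumRep (ρ : Representation ℂ G X) (H : Subgroup G) :
    Representation ℂ (EffectiveGroup H) (fixedSpace ρ H) :=
  QuotientGroup.lift _ (normalizerRep ρ H) (by
    intro n hn
    ext x
    exact x.2 n hn)

end Stratum

/-- The number of involutions `#Inv(Γ) = #{σ ∈ Γ | σ² = 1}` (the identity is counted). -/
noncomputable def numInvolutions (Γ : Type*) [Group Γ] : ℕ :=
  Nat.card {σ : Γ // σ ^ 2 = 1}

section Invariants

variable {W : Type*} [AddCommGroup W] [Module ℂ W] {Γ : Type*} [Group Γ]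

/-- The real vector space of complex linear forms on `W` that are defined over `ℝ`. -/
def realForms (c : RealStructure W) : Submodule ℝ (W →ₗ[ℂ] ℂ) where
  carrier := {l | ∀ x, l (c.conj x) = star (l x)}
  add_mem' := fun ha hb x => by simp [ha x, hb x]
  zero_mem' := fun x => by simp
  smul_mem' := fun t l hl x => by simp [hl x]

/-- Linear forms defined over `ℝ` separate points. -/
theorem eq_zero_of_realForms (c : RealStructure W) {v : W}
    (hv : ∀ l ∈ realForms c, l v = 0) : v = 0 := by
  refine (Module.forall_dual_apply_eq_zero_iff ℂ v).1 fun φ => ?_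
  let ψ : W →ₗ[ℂ] ℂ :=
    { toFun := fun x => star (φ (c.conj x))
      map_add' := fun x y => by simp
      map_smul' := fun t x => by simp }
  have hψ : ∀ x, ψ x = star (φ (c.conj x)) := fun _ => rfl
  have h1 := hv (φ + ψ) fun x => by
    simp only [LinearMap.add_apply, hψ, c.conj_conj, star_add, star_star]
    exact add_comm _ _
  have h2 := hv (Complex.I • (φ - ψ)) fun x => by
    simp only [LinearMap.smul_apply, LinearMap.sub_apply, hψ, c.conj_conj, smul_eq_mul, star_mul',
      star_sub, Complex.star_def, Complex.conj_I, Complex.conj_conj]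
    ring
  simp only [LinearMap.smul_apply, LinearMap.sub_apply, LinearMap.add_apply, smul_eq_mul,
    mul_eq_zero, Complex.I_ne_zero, false_or] at h1 h2
  linear_combination (h1 + h2) / 2

theorem coordRing_apply_conj (c : RealStructure W) {f : W → ℂ} (hf : f ∈ coordRing c) (x : W) :
    f (c.conj x) = star (f x) := by
  induction hf using Algebra.adjoin_induction with
  | mem f hf => obtain ⟨l, hl, rfl⟩ := hf; exact hl x
  | algebraMap t => simp [Pi.algebraMap_apply]
  | add f g _ _ hf hg => simp [hf, hg]
  | mul f g _ _ hf hg => simp [hf, hg]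

/-- If all invariants defined over `ℝ` agree on `x` and `y`, then every linear form defined over
`ℝ` takes at `y` one of its values on the orbit of `x`. -/
theorem exists_realForm_apply_eq [Finite Γ] (c : RealStructure W) (ρ : Representation ℂ Γ W)
    (hc : ∀ g x, ρ g (c.conj x) = c.conj (ρ g x)) {x y : W}
    (h : quotMap c ρ x = quotMap c ρ y) {l : W →ₗ[ℂ] ℂ} (hl : l ∈ realForms c) :
    ∃ g, l (ρ g x) = l y := by
  have := Fintype.ofFinite Γ
  have hmem : ∀ g, (fun z => l (ρ g z)) ∈ coordRing c := fun g =>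
    Algebra.subset_adjoin ⟨l ∘ₗ ρ g, fun z => by simp [hc, hl (ρ g z)], rfl⟩
  let P : Polynomial (coordRing c) := ∏ g, (Polynomial.X - Polynomial.C ⟨_, hmem g⟩)
  let ev (z : W) : coordRing c →+* ℂ :=
    ((Pi.evalAlgHom ℝ (fun _ : W => ℂ) z).comp (coordRing c).val : coordRing c →ₐ[ℝ] ℂ)
  have hev : ∀ z, P.map (ev z) = ∏ g, (Polynomial.X - Polynomial.C (l (ρ g z))) := fun z => by
    simp [P, ev, Polynomial.map_prod]
  have hinv : ∀ g z, P.map (ev (ρ g z)) = P.map (ev z) := fun g z => by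
    rw [hev, hev, ← Equiv.prod_comp (Equiv.mulRight g)
      (fun a => Polynomial.X - Polynomial.C (l (ρ a z)))]
    simp
  have hxy : P.map (ev x) = P.map (ev y) := by
    ext k
    have hk : (P.coeff k : W → ℂ) ∈ invariantRing c ρ := ⟨(P.coeff k).2, fun g z => by
      simpa [ev] using congrArg (fun p => p.coeff k) (hinv g z)⟩
    simpa [ev, quotMap] using DFunLike.congr_fun h ⟨_, hk⟩
  have h0 := congrArg (Polynomial.eval (l y)) hxy
  rw [hev, hev, Polynomial.eval_prod, Polynomial.eval_prod,
    Finset.prod_eq_zero (Finset.mem_univ (1 : Γ)) (f := fun g => Polynomial.eval (l y)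
      (Polynomial.X - Polynomial.C (l (ρ g y)))) (by simp), Finset.prod_eq_zero_iff] at h0
  obtain ⟨g, -, hg⟩ := h0
  rw [Polynomial.eval_sub, Polynomial.eval_X, Polynomial.eval_C, sub_eq_zero] at hg
  exact ⟨g, hg.symm⟩

/-- The fibres of the quotient map are the orbits. -/
theorem quotMap_eq_iff [Finite Γ] (c : RealStructure W) (ρ : Representation ℂ Γ W)
    (hc : ∀ g x, ρ g (c.conj x) = c.conj (ρ g x)) {x y : W} :
    quotMap c ρ x = quotMap c ρ y ↔ ∃ g, ρ g x = y := by
  constructor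
  · intro h
    let p : Γ → Subspace ℝ (realForms c) := fun g =>
      { carrier := {l | (l : W →ₗ[ℂ] ℂ) (ρ g x - y) = 0}
        add_mem' := fun {a b} ha hb => by
          rw [Set.mem_ofPred_eq] at *
          rw [Submodule.coe_add, LinearMap.add_apply, ha, hb, add_zero]
        zero_mem' := by simp
        smul_mem' := fun t a ha => by
          rw [Set.mem_ofPred_eq] at *
          rw [Submodule.coe_smul, LinearMap.smul_apply, ha, smul_zero] }
    obtain ⟨g, hg⟩ := Subspace.exists_eq_top_of_iUnion_eq_univ (p := p) <| by
      refine Set.eq_univ_of_forall fun l => Set.mem_iUnion.2 ?_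
      obtain ⟨g, hg⟩ := exists_realForm_apply_eq c ρ hc h l.2
      exact ⟨g, show (l : W →ₗ[ℂ] ℂ) (ρ g x - y) = 0 by rw [map_sub, hg, sub_self]⟩
    refine ⟨g, sub_eq_zero.1 (eq_zero_of_realForms c fun l hl => ?_)⟩
    exact show (⟨l, hl⟩ : realForms c) ∈ p g from hg ▸ Submodule.mem_top
  · rintro ⟨g, rfl⟩
    ext f
    exact (f.2.2 g x).symm

/-- `π(x)` is a real point exactly when `x` and its conjugate lie in the same orbit. -/
theorem quotMap_mem_range_iff [Finite Γ] (c : RealStructure W) (ρ : Representation ℂ Γ W)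
    (hc : ∀ g x, ρ g (c.conj x) = c.conj (ρ g x)) {x : W} :
    (∃ y, realToComplexPoint c ρ y = quotMap c ρ x) ↔ ∃ g, c.conj x = ρ g x := by
  have hreal : (∃ y, realToComplexPoint c ρ y = quotMap c ρ x) ↔
      quotMap c ρ x = quotMap c ρ (c.conj x) := by
    constructor
    · rintro ⟨y, hy⟩
      ext f
      have hf : ((y f : ℝ) : ℂ) = (f : W → ℂ) x := DFunLike.congr_fun hy f
      change (f : W → ℂ) x = (f : W → ℂ) (c.conj x)
      rw [coordRing_apply_conj c f.2.1, ← hf]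
      simp
    · intro h
      have him : ∀ f : invariantRing c ρ, ((((f : W → ℂ) x).re : ℝ) : ℂ) = (f : W → ℂ) x := by
        intro f
        have hf : (f : W → ℂ) x = (f : W → ℂ) (c.conj x) := DFunLike.congr_fun h f
        rw [coordRing_apply_conj c f.2.1] at hf
        exact Complex.conj_eq_iff_re.1 hf.symm
      refine ⟨⟨⟨⟨⟨fun f => ((f : W → ℂ) x).re, ?_⟩, ?_⟩, ?_, ?_⟩, ?_⟩, ?_⟩
      · simp
      · intro a b
        apply Complex.ofReal_injective
        rw [Complex.ofReal_mul, him, him, him]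
        rfl
      · simp
      · intro a b
        simp
      · intro t
        simp [Pi.algebraMap_apply]
      · ext f
        exact him f
  rw [hreal, quotMap_eq_iff c ρ hc]
  simp only [eq_comm]

end Invariants

section TwistedReal

variable {W : Type*} [AddCommGroup W] [Module ℂ W] {Γ : Type*} [Group Γ]

/-- The real subspace on which complex conjugation acts as the group element `σ`. -/
def twistedReal (c : RealStructure W) (ρ : Representation ℂ Γ W) (σ : Γ) : Submodule ℝ W where
  carrier := {x | c.conj x = ρ σ x}
  add_mem' := fun {a b} ha hb => by
    rw [Set.mem_ofPred_eq] at *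
    rw [map_add, map_add, ha, hb]
  zero_mem' := by simp
  smul_mem' := fun t x hx => by
    rw [Set.mem_ofPred_eq] at *
    rw [← Complex.coe_smul, map_smulₛₗ c.conj, map_smul, hx, Complex.conj_ofReal]

theorem mem_twistedReal {c : RealStructure W} {ρ : Representation ℂ Γ W} {σ : Γ} {x : W} :
    x ∈ twistedReal c ρ σ ↔ c.conj x = ρ σ x := Iff.rfl

/-- `(a, b) ↦ a + i b`, the complexification of the inclusion of a real subspace. -/
noncomputable def complexifyMap (S : Submodule ℝ W) : S × S →ₗ[ℝ] W where
  toFun p := (p.1 : W) + Complex.I • (p.2 : W)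
  map_add' p q := by simp only [Prod.fst_add, Prod.snd_add, Submodule.coe_add, smul_add]; abel
  map_smul' t p := by
    simp only [Prod.smul_fst, Prod.smul_snd, Submodule.coe_smul, smul_add, RingHom.id_apply]
    rw [smul_comm]

theorem complexifyMap_injective {c : RealStructure W} {ρ : Representation ℂ Γ W} {σ : Γ}
    {S : Submodule ℝ W} (hS : S ≤ twistedReal c ρ σ) :
    Function.Injective (complexifyMap S) := by
  rw [← LinearMap.ker_eq_bot, LinearMap.ker_eq_bot']
  rintro ⟨a, b⟩ h
  have h1 : (a : W) + Complex.I • (b : W) = 0 := h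
  have ha := mem_twistedReal.1 (hS a.2)
  have hb := mem_twistedReal.1 (hS b.2)
  have h2 : ρ σ ((a : W) - Complex.I • (b : W)) = 0 := by
    have := congrArg c.conj h1
    rw [map_add, map_smulₛₗ, ha, hb, map_zero, Complex.conj_I, neg_smul] at this
    rwa [map_sub, map_smul, sub_eq_add_neg]
  have h3 : (a : W) - Complex.I • (b : W) = 0 := by
    simpa [← Module.End.mul_apply, ← map_mul] using congrArg (ρ σ⁻¹) h2
  have ha0 : (a : W) = 0 := by
    have : (2 : ℂ) • (a : W) = 0 := by
      rw [two_smul]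
      calc (a : W) + a = ((a : W) + Complex.I • (b : W)) + (a - Complex.I • (b : W)) := by abel
        _ = 0 := by rw [h1, h3, add_zero]
    simpa using this
  have hb0 : (b : W) = 0 := by simpa [ha0] using h1
  exact Prod.ext (Subtype.ext ha0) (Subtype.ext hb0)

/-- A subspace of a twisted real form that lies in a proper complex subspace has real dimension
less than the complex dimension of the ambient space. -/
theorem finrank_lt_of_le_twistedReal [FiniteDimensional ℂ W] {c : RealStructure W}
    {ρ : Representation ℂ Γ W} {σ : Γ} {S : Submodule ℝ W} (hS : S ≤ twistedReal c ρ σ)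
    {V : Submodule ℂ W} (hV : V ≠ ⊤) (hSV : ∀ x ∈ S, x ∈ V) :
    Module.finrank ℝ S < Module.finrank ℂ W := by
  have h1 : Module.finrank ℝ (S × S) ≤ Module.finrank ℝ V :=
    LinearMap.finrank_le_finrank_of_injective
      (f := (complexifyMap S).codRestrict (V.restrictScalars ℝ) fun p =>
        V.add_mem (hSV _ p.1.2) (V.smul_mem _ (hSV _ p.2.2)))
      (fun p q h => complexifyMap_injective hS (congrArg Subtype.val h))
  have h2 := Submodule.finrank_lt hV
  have h3 := finrank_real_of_complex V
  rw [Module.finrank_prod] at h1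
  omega

/-- If `σ² = 1`, then `σ` twists the real structure into another one, whose real points have real
dimension `dim_ℂ W`. -/
theorem finrank_twistedReal [FiniteDimensional ℂ W] (c : RealStructure W)
    (ρ : Representation ℂ Γ W) (hc : ∀ g x, ρ g (c.conj x) = c.conj (ρ g x)) {σ : Γ}
    (hσ : σ ^ 2 = 1) : Module.finrank ℝ (twistedReal c ρ σ) = Module.finrank ℂ W := by
  have hσ' : ∀ x, ρ σ (ρ σ x) = x := fun x => by
    rw [← Module.End.mul_apply, ← map_mul, ← sq, hσ, map_one, Module.End.one_apply]
  have hsurj : Function.Surjective (complexifyMap (twistedReal c ρ σ)) := by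
    intro x
    let t : W := ρ σ (c.conj x)
    have h2 : (starRingEnd ℂ) 2 = 2 := Complex.conj_ofNat 2
    have ht : c.conj t = ρ σ x := by simp only [t]; rw [← hc, c.conj_conj]
    have ht' : ρ σ t = c.conj x := hσ' _
    refine ⟨⟨⟨(1 / 2 : ℂ) • (x + t), ?_⟩, ⟨(-Complex.I / 2 : ℂ) • (x - t), ?_⟩⟩, ?_⟩
    · rw [mem_twistedReal, map_smulₛₗ c.conj, map_smul, map_add, map_add, ht, ht', add_comm]
      simp [h2]
    · rw [mem_twistedReal, map_smulₛₗ c.conj, map_smul, map_sub, map_sub, ht, ht',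
        ← neg_sub (ρ σ x), smul_neg, ← neg_smul]
      simp [neg_div, h2]
    · change (1 / 2 : ℂ) • (x + t) + Complex.I • (-Complex.I / 2 : ℂ) • (x - t) = x
      rw [smul_smul, show Complex.I * (-Complex.I / 2) = 1 / 2 by
        linear_combination (-1 / 2 : ℂ) * Complex.I_mul_I, ← smul_add, add_add_sub_cancel,
        ← two_smul ℂ x, smul_smul]
      norm_num
  have h := (LinearEquiv.ofBijective _ ⟨complexifyMap_injective le_rfl, hsurj⟩).finrank_eq
  rw [Module.finrank_prod, finrank_real_of_complex] at h
  omega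

/-- If `σ² ≠ 1` and the action is faithful, the twisted real subspace has deficient dimension. -/
theorem finrank_twistedReal_lt [FiniteDimensional ℂ W] (c : RealStructure W)
    (ρ : Representation ℂ Γ W) (hc : ∀ g x, ρ g (c.conj x) = c.conj (ρ g x))
    (hρ : Function.Injective ρ) {σ : Γ} (hσ : σ ^ 2 ≠ 1) :
    Module.finrank ℝ (twistedReal c ρ σ) < Module.finrank ℂ W := by
  refine finrank_lt_of_le_twistedReal le_rfl (V := LinearMap.ker (ρ (σ ^ 2) - 1)) ?_ ?_
  · rw [Ne, LinearMap.ker_eq_top, sub_eq_zero, ← map_one ρ]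
    exact fun h => hσ (hρ h)
  · intro x hx
    rw [mem_twistedReal] at hx
    rw [LinearMap.mem_ker, LinearMap.sub_apply, sub_eq_zero, sq, map_mul, Module.End.mul_apply,
      ← hx, hc, ← hx, c.conj_conj, Module.End.one_apply]

/-- Distinct twisted real subspaces meet in deficient dimension if the action is faithful. -/
theorem finrank_twistedReal_inf_lt [FiniteDimensional ℂ W] (c : RealStructure W)
    (ρ : Representation ℂ Γ W) (hρ : Function.Injective ρ) {σ τ : Γ} (h : σ ≠ τ) :
    Module.finrank ℝ (twistedReal c ρ σ ⊓ twistedReal c ρ τ : Submodule ℝ W) <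
      Module.finrank ℂ W := by
  refine finrank_lt_of_le_twistedReal inf_le_left (V := LinearMap.ker (ρ σ - ρ τ)) ?_ ?_
  · rw [Ne, LinearMap.ker_eq_top, sub_eq_zero]
    exact fun h' => h (hρ h')
  · rintro x ⟨hx, hx'⟩
    rw [LinearMap.mem_ker, LinearMap.sub_apply, sub_eq_zero]
    exact (mem_twistedReal.1 hx).symm.trans (mem_twistedReal.1 hx')

end TwistedReal

section Volume

/-- A subspace of dimension less than `d` is null for the `d`-dimensional Hausdorff measure. -/
theorem hausdorffMeasure_submodule_eq_zero {E : Type*} [NormedAddCommGroup E] [NormedSpace ℝ E]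
    [FiniteDimensional ℝ E] [MeasurableSpace E] [BorelSpace E] (S : Submodule ℝ E) {d : ℕ}
    (h : Module.finrank ℝ S < d) : Measure.hausdorffMeasure (d : ℝ) (S : Set E) = 0 := by
  rw [← NNReal.coe_natCast]
  apply hausdorffMeasure_of_dimH_lt
  rw [← Subtype.range_coe (s := (S : Set E)), ← Set.image_univ,
    (isometry_subtype_coe (s := (S : Set E))).dimH_image]
  refine (Real.dimH_univ_eq_finrank S).trans_lt ?_
  exact_mod_cast h

/-- The `d`-dimensional Hausdorff measure of a centred ball in a `d`-dimensional subspace of an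
inner product space is that of the ball in Euclidean space. -/
theorem hausdorffMeasure_submodule_inter_ball {E : Type*} [NormedAddCommGroup E]
    [InnerProductSpace ℝ E] [MeasurableSpace E] [BorelSpace E] (S : Submodule ℝ E)
    [FiniteDimensional ℝ S] {d : ℕ} (h : Module.finrank ℝ S = d) (r : ℝ) :
    Measure.hausdorffMeasure (d : ℝ) ((S : Set E) ∩ Metric.ball 0 r) =
      Measure.hausdorffMeasure (d : ℝ) (Metric.ball (0 : EuclideanSpace ℝ (Fin d)) r) := by
  let e : EuclideanSpace ℝ (Fin d) ≃ₗᵢ[ℝ] S :=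
    ((stdOrthonormalBasis ℝ S).reindex (finCongr h)).repr.symm
  have hiso : Isometry (fun x => (e x : E)) := S.subtypeₗᵢ.isometry.comp e.isometry
  rw [← hiso.hausdorffMeasure_image (Or.inl (Nat.cast_nonneg d))]
  congr 1
  ext x
  constructor
  · rintro ⟨hx, hx'⟩
    refine ⟨e.symm ⟨x, hx⟩, ?_, by simp⟩
    rw [mem_ball_zero_iff] at hx' ⊢
    rwa [e.symm.norm_map]
  · rintro ⟨y, hy, rfl⟩
    refine ⟨(e y).2, ?_⟩
    rw [mem_ball_zero_iff] at hy ⊢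
    rw [← e.norm_map] at hy
    exact hy

theorem hausdorffMeasure_euclidean_ball_ne (d : ℕ) {r : ℝ} (hr : 0 < r) :
    Measure.hausdorffMeasure (d : ℝ) (Metric.ball (0 : EuclideanSpace ℝ (Fin d)) r) ≠ 0 ∧
      Measure.hausdorffMeasure (d : ℝ) (Metric.ball (0 : EuclideanSpace ℝ (Fin d)) r) ≠ ⊤ := by
  have : (Measure.hausdorffMeasure (d : ℝ) :
      Measure (EuclideanSpace ℝ (Fin d))).IsAddHaarMeasure := by
    simpa using isAddHaarMeasure_hausdorffMeasure (E := EuclideanSpace ℝ (Fin d))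
  exact ⟨(Metric.measure_ball_pos _ _ hr).ne', measure_ball_lt_top.ne⟩

variable {W : Type*} [NormedAddCommGroup W] [InnerProductSpace ℂ W] {Γ : Type*} [Group Γ]
  [Finite Γ] (c : RealStructure W) (ρ : Representation ℂ Γ W)

/-- The quotient distance to the origin is the norm. -/
theorem quotDist_quotMap_zero (hc : ∀ g x, ρ g (c.conj x) = c.conj (ρ g x))
    (hnorm : ∀ g x, ‖ρ g x‖ = ‖x‖) (x : W) :
    quotDist c ρ (quotMap c ρ x) (quotMap c ρ 0) = ‖x‖ := by
  have : {d | ∃ z z' : W, quotMap c ρ z = quotMap c ρ x ∧ quotMap c ρ z' = quotMap c ρ 0 ∧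
      d = dist z z'} = {‖x‖} := by
    ext d
    constructor
    · rintro ⟨z, z', hz, hz', rfl⟩
      obtain ⟨g, rfl⟩ := (quotMap_eq_iff c ρ hc).1 hz.symm
      obtain ⟨g', rfl⟩ := (quotMap_eq_iff c ρ hc).1 hz'.symm
      rw [map_zero, dist_zero_right, hnorm]
      rfl
    · rintro rfl
      exact ⟨x, 0, rfl, rfl, (dist_zero_right x).symm⟩
  rw [quotDist, this, csInf_singleton]

theorem preimage_quotBall (hc : ∀ g x, ρ g (c.conj x) = c.conj (ρ g x))
    (hnorm : ∀ g x, ‖ρ g x‖ = ‖x‖) (r : ℝ) :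
    quotMap c ρ ⁻¹' (realToComplexPoint c ρ '' quotBall c ρ r) =
      ⋃ σ, (twistedReal c ρ σ : Set W) ∩ Metric.ball 0 r := by
  ext x
  rw [← Set.iUnion_inter, Set.mem_inter_iff, Set.mem_iUnion, mem_ball_zero_iff,
    ← quotDist_quotMap_zero c ρ hc hnorm]
  simp only [SetLike.mem_coe, mem_twistedReal]
  rw [← quotMap_mem_range_iff c ρ hc]
  constructor
  · rintro ⟨y, hy, hyx⟩
    exact ⟨⟨y, hyx⟩, hyx ▸ hy⟩
  · rintro ⟨⟨y, hyx⟩, hx⟩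
    exact ⟨y, by rwa [quotBall, Set.mem_ofPred_eq, hyx], hyx⟩

theorem preimage_realImage_inter_quotBall (hc : ∀ g x, ρ g (c.conj x) = c.conj (ρ g x))
    (hnorm : ∀ g x, ‖ρ g x‖ = ‖x‖) (r : ℝ) :
    quotMap c ρ ⁻¹' (realToComplexPoint c ρ '' (realImage c ρ ∩ quotBall c ρ r)) =
      (twistedReal c ρ 1 : Set W) ∩ Metric.ball 0 r := by
  ext x
  rw [Set.mem_inter_iff, mem_ball_zero_iff, ← quotDist_quotMap_zero c ρ hc hnorm]
  simp only [SetLike.mem_coe, mem_twistedReal, map_one, Module.End.one_apply]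
  constructor
  · rintro ⟨y, ⟨⟨z, hz, hzy⟩, hy⟩, hyx⟩
    refine ⟨?_, hyx ▸ hy⟩
    obtain ⟨g, rfl⟩ := (quotMap_eq_iff c ρ hc).1 (hzy.trans hyx)
    rw [← hc, show c.conj z = z from hz]
  · rintro ⟨hx, hxr⟩
    obtain ⟨y, hyx⟩ := (quotMap_mem_range_iff c ρ hc).2 ⟨1, by simpa using hx⟩
    exact ⟨y, ⟨⟨x, hx, hyx.symm⟩, by rwa [quotBall, Set.mem_ofPred_eq, hyx]⟩, hyx⟩

variable [FiniteDimensional ℂ W]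

theorem quotVol_realImage_inter_quotBall (hc : ∀ g x, ρ g (c.conj x) = c.conj (ρ g x))
    (hnorm : ∀ g x, ‖ρ g x‖ = ‖x‖) (r : ℝ) :
    quotVol c ρ (realImage c ρ ∩ quotBall c ρ r) = (Nat.card Γ : ℝ≥0∞)⁻¹ *
      Measure.hausdorffMeasure (Module.finrank ℂ W : ℝ)
        (Metric.ball (0 : EuclideanSpace ℝ (Fin (Module.finrank ℂ W))) r) := by
  let _ : MeasurableSpace W := borel W
  have : BorelSpace W := ⟨rfl⟩
  let _ : InnerProductSpace ℝ W := InnerProductSpace.complexToReal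
  rw [quotVol, preimage_realImage_inter_quotBall c ρ hc hnorm,
    hausdorffMeasure_submodule_inter_ball _ (finrank_twistedReal c ρ hc (one_pow 2))]

theorem quotVol_quotBall (hc : ∀ g x, ρ g (c.conj x) = c.conj (ρ g x))
    (hnorm : ∀ g x, ‖ρ g x‖ = ‖x‖) (hρ : Function.Injective ρ) (r : ℝ) :
    quotVol c ρ (quotBall c ρ r) = (Nat.card Γ : ℝ≥0∞)⁻¹ * ((numInvolutions Γ : ℝ≥0∞) *
      Measure.hausdorffMeasure (Module.finrank ℂ W : ℝ)
        (Metric.ball (0 : EuclideanSpace ℝ (Fin (Module.finrank ℂ W))) r)) := by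
  classical
  let _ : MeasurableSpace W := borel W
  have : BorelSpace W := ⟨rfl⟩
  let _ : InnerProductSpace ℝ W := InnerProductSpace.complexToReal
  have := Fintype.ofFinite Γ
  have hmeas : ∀ σ, MeasurableSet ((twistedReal c ρ σ : Set W) ∩ Metric.ball 0 r) := fun σ =>
    (Submodule.closed_of_finiteDimensional _).measurableSet.inter measurableSet_ball
  have hterm : ∀ σ, Measure.hausdorffMeasure (Module.finrank ℂ W : ℝ)
      ((twistedReal c ρ σ : Set W) ∩ Metric.ball 0 r) = if σ ^ 2 = 1 then
        Measure.hausdorffMeasure (Module.finrank ℂ W : ℝ)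
          (Metric.ball (0 : EuclideanSpace ℝ (Fin (Module.finrank ℂ W))) r) else 0 := by
    intro σ
    split_ifs with hσ
    · exact hausdorffMeasure_submodule_inter_ball _ (finrank_twistedReal c ρ hc hσ) r
    · exact measure_mono_null Set.inter_subset_left
        (hausdorffMeasure_submodule_eq_zero _ (finrank_twistedReal_lt c ρ hc hρ hσ))
  rw [quotVol, preimage_quotBall c ρ hc hnorm, measure_iUnion₀ _ fun σ =>
    (hmeas σ).nullMeasurableSet]
  · simp_rw [hterm]
    rw [tsum_fintype, Finset.sum_ite, Finset.sum_const_zero, add_zero, Finset.sum_const,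
      nsmul_eq_mul, numInvolutions, Nat.card_eq_fintype_card, Nat.card_eq_fintype_card,
      Fintype.card_subtype]
  · intro σ τ h
    refine measure_mono_null ?_
      (hausdorffMeasure_submodule_eq_zero _ (finrank_twistedReal_inf_lt c ρ hρ h))
    exact fun x hx => ⟨hx.1.1, hx.2.1⟩

end Volume

theorem lemma4p5 {G : Type*} [Group G] [Finite G]
    {X : Type*} [NormedAddCommGroup X] [InnerProductSpace ℂ X] [FiniteDimensional ℂ X]
    (c : RealStructure X) (ρ : Representation ℂ G X)
    (hreal : ∀ g x, ρ g (c.conj x) = c.conj (ρ g x))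
    (hinv : ∀ g x y, inner ℂ (ρ g x) (ρ g y) = inner ℂ x y)
    (H : Subgroup G) (hfaithful : Function.Injective (stratumRep ρ H))
    (r : ℝ) (hr : 0 < r) :
    quotVol (stratumReal c ρ hreal H) (stratumRep ρ H)
        (quotBall (stratumReal c ρ hreal H) (stratumRep ρ H) r) ≠ 0 ∧
    quotVol (stratumReal c ρ hreal H) (stratumRep ρ H)
        (quotBall (stratumReal c ρ hreal H) (stratumRep ρ H) r) ≠ ⊤ ∧
    quotVol (stratumReal c ρ hreal H) (stratumRep ρ H)
        (realImage (stratumReal c ρ hreal H) (stratumRep ρ H) ∩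
          quotBall (stratumReal c ρ hreal H) (stratumRep ρ H) r) /
      quotVol (stratumReal c ρ hreal H) (stratumRep ρ H)
        (quotBall (stratumReal c ρ hreal H) (stratumRep ρ H) r) =
      1 / (numInvolutions (EffectiveGroup H) : ℝ≥0∞) := by
  have hc : ∀ g x, stratumRep ρ H g ((stratumReal c ρ hreal H).conj x) =
      (stratumReal c ρ hreal H).conj (stratumRep ρ H g x) := by
    intro g x
    obtain ⟨n, rfl⟩ := QuotientGroup.mk_surjective g
    exact Subtype.ext (hreal n x)
  have hnorm : ∀ g x, ‖stratumRep ρ H g x‖ = ‖x‖ := by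
    intro g x
    obtain ⟨n, rfl⟩ := QuotientGroup.mk_surjective g
    change ‖ρ (n : G) (x : X)‖ = ‖(x : X)‖
    rw [@norm_eq_sqrt_re_inner ℂ, @norm_eq_sqrt_re_inner ℂ, hinv]
  obtain ⟨h0, htop⟩ :=
    hausdorffMeasure_euclidean_ball_ne (Module.finrank ℂ (fixedSpace ρ H)) hr
  have hcard : (Nat.card (EffectiveGroup H) : ℝ≥0∞)⁻¹ ≠ 0 := by simp
  have hcard' : (Nat.card (EffectiveGroup H) : ℝ≥0∞)⁻¹ ≠ ⊤ :=
    ENNReal.inv_ne_top.2 (Nat.cast_ne_zero.2 Nat.card_pos.ne')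
  have hN : (numInvolutions (EffectiveGroup H) : ℝ≥0∞) ≠ 0 := by
    have : Nonempty {σ : EffectiveGroup H // σ ^ 2 = 1} := ⟨⟨1, one_pow 2⟩⟩
    exact Nat.cast_ne_zero.2 Nat.card_pos.ne'
  have hN' : (numInvolutions (EffectiveGroup H) : ℝ≥0∞) ≠ ⊤ := ENNReal.natCast_ne_top _
  rw [quotVol_quotBall _ _ hc hnorm hfaithful, quotVol_realImage_inter_quotBall _ _ hc hnorm]
  refine ⟨mul_ne_zero hcard (mul_ne_zero hN h0),
    ENNReal.mul_ne_top hcard' (ENNReal.mul_ne_top hN' htop), ?_⟩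
  rw [ENNReal.mul_div_mul_left _ _ hcard hcard']
  nth_rewrite 1 [← one_mul (Measure.hausdorffMeasure _ _)]
  exact ENNReal.mul_div_mul_right _ _ h0 htop
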